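/- Let $0<\mu_1<\mu_2<\cdots$ be real numbers such that (A1) there are $M>0$, $\sigma\in(0,1]$ and $\beta>1$ with $\mu_n = M n^{\beta}\bigl(1+o(n^{-\sigma})\bigr)$ as $n\to\infty$; (A2) there are $\theta>0$ and $s\ge 0$ with $\mu_{n+1}-\mu_n\ge \theta n^{-s}$ for every $n\ge 1$. Let $0<T\le\infty$ (with $[0,T]$ read as $[0,\infty)$ if $T=\infty$), let $(c_n)_{n\ge1}$ and $(f_n)_{n\ge1}$ be sequences of real (or of complex) numbers with $c_n\ne 0$ for all $n$, and let $\tau>0$. If $$\sum_{n=1}^{\infty}\left|\frac{f_n}{c_n}\right|^2 e^{-2\mu_n\tau_0}<\infty$$ for some $\tau_0\in[0,\tau)$, then the exponential moment problem $$\int_0^T e^{-\mu_n t}\,\nu(t)\,dt = m_n := e^{-\mu_n\tau}\,\frac{f_n}{c_n},\qquad n=1,2,\dots,$$ has a solution $\nu\in L^2[0,T]$ (real-valued, respectively complex-valued). -/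

import Mathlib

open MeasureTheory Filter Asymptotics

noncomputable section

/-- All sequences are indexed by `ℕ` starting at `0`: the term `μ n` stands for the
`(n+1)`-st member of the sequence, `μ_{n+1}`.

Growth assumption: `μ_n = M n^β (1 + o(n^{-σ}))` for certain `M > 0`, `σ ∈ (0, 1]`
and `β > 1`. The function `ε` is the `o(n^{-σ})` term. -/
def HasPowerGrowth (μ : ℕ → ℝ) : Prop :=
  ∃ M σ β : ℝ, 0 < M ∧ 0 < σ ∧ σ ≤ 1 ∧ 1 < β ∧
    ∃ ε : ℕ → ℝ,
      ε =o[atTop] (fun n : ℕ => ((n : ℝ) + 1) ^ (-σ)) ∧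
      ∀ n : ℕ, μ n = M * ((n : ℝ) + 1) ^ β * (1 + ε n)

/-- Gap assumption: `μ_{n+1} - μ_n ≥ θ n^{-s}` for each `n ≥ 1`, for certain `θ > 0`
and `s ≥ 0`. -/
def HasPowerGap (μ : ℕ → ℝ) : Prop :=
  ∃ θ s : ℝ, 0 < θ ∧ 0 ≤ s ∧
    ∀ n : ℕ, θ * ((n : ℝ) + 1) ^ (-s) ≤ μ (n + 1) - μ n

/-- The time interval `[0, T]`, for a finite or infinite `T`; it is `[0, ∞)` for `T = ∞`. -/
def timeInterval (T : EReal) : Set ℝ :=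
  {t : ℝ | 0 ≤ t ∧ (t : EReal) ≤ T}

/-- `ν` is a solution in `L²[0, T]` of the exponential moment problem
`∫_0^T e^{-μ_n t} ν(t) dt = m_n` for all `n`. -/
def IsMomentSolution {𝕜 : Type*} [RCLike 𝕜] (μ : ℕ → ℝ) (m : ℕ → 𝕜) (T : EReal)
    (ν : ℝ → 𝕜) : Prop :=
  MemLp ν 2 (volume.restrict (timeInterval T)) ∧
    ∀ n : ℕ, ∫ t in timeInterval T, ((Real.exp (-(μ n) * t) : ℝ) : 𝕜) * ν t = m n

end

/-! On a finite interval, functions `g_n` biorthogonal to the exponentials would give `ν = ∑ m_n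
g_n`; this converges when `‖g_n‖_∞` is at most `C e^{δ μ_n}` with `δ < τ - τ₀`.

Finitely many orthogonality conditions are met explicitly: convolving an indicator with `δ_0 -
e^{μ_k h_k} δ_{h_k}` makes the Laplace transform vanish at `μ_k`, at the cost of a factor `1 +
e^{μ_k h_k}` in sup norm and a length `h_k` of support. Omit `k = n` and divide by the value at
`μ_n`. With `h_k` proportional to `(k+1)^{-p}`, `1 < p < β`, the support stays in `[0, T]`, and
growth and gaps bound the normalised product by `C e^{δ μ_n}` for any `δ > 0`, uniformly in the
number of factors (`exists_biorthogonal_section`).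

The finite sections thus have uniformly bounded solutions, and weak-* compactness
(`exists_inner_eq_of_bounded_sections`) yields a solution of the full problem. -/

theorem integrable_exp_mul_of_bounded_of_support {g : ℝ → ℝ} {A b : ℝ} (hg : Measurable g)
    (hA : ∀ t, |g t| ≤ A) (hs : ∀ t, t ∉ Set.Icc 0 b → g t = 0) (z : ℝ) :
    Integrable (fun t => Real.exp (-z * t) * g t) := by
  have hA0 : 0 ≤ A := (abs_nonneg _).trans (hA 0)
  have hsup : Function.support (fun t => Real.exp (-z * t) * g t) ⊆ Set.Icc 0 b := by
    intro t ht
    by_contra hc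
    exact ht (by simp [hs t hc])
  rw [← integrableOn_iff_integrable_of_support_subset hsup]
  refine Measure.integrableOn_of_bounded (M := Real.exp (|z| * |b|) * A) (by simp)
    (by fun_prop) ?_
  rw [ae_restrict_iff' measurableSet_Icc]
  refine Eventually.of_forall fun t ht => ?_
  rw [norm_mul, Real.norm_eq_abs, Real.norm_eq_abs, Real.abs_exp]
  have h1 : -z * t ≤ |z| * |b| := by
    calc -z * t ≤ |z| * t := mul_le_mul_of_nonneg_right (neg_le_abs z) ht.1
      _ ≤ |z| * |b| := mul_le_mul_of_nonneg_left (ht.2.trans (le_abs_self b)) (abs_nonneg z)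
  gcongr
  exact hA t

theorem integral_Icc_exp_neg_mul {z b : ℝ} (hz : z ≠ 0) (hb : 0 ≤ b) :
    ∫ t in Set.Icc 0 b, Real.exp (-z * t) = (1 - Real.exp (-z * b)) / z := by
  rw [integral_Icc_eq_integral_Ioc, ← intervalIntegral.integral_of_le hb,
    intervalIntegral.integral_comp_mul_left (fun x => Real.exp x) (neg_ne_zero.2 hz), integral_exp]
  simp only [mul_zero, Real.exp_zero, smul_eq_mul]
  field_simp
  ring

/-- A finite convolution of the two-point measures `δ_0 - e^{λ_k h_k} δ_{h_k}` with the indicator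
of an interval: its Laplace transform vanishes at each `λ_k`. -/
theorem exists_bounded_laplace_eq_prod (lam h : ℕ → ℝ) (hh : ∀ k, 0 ≤ h k) {b : ℝ} (hb : 0 ≤ b)
    (S : Finset ℕ) :
    ∃ g : ℝ → ℝ, Measurable g ∧ (∀ t, |g t| ≤ ∏ k ∈ S, (1 + Real.exp (lam k * h k))) ∧
      (∀ t, t ∉ Set.Icc 0 (b + ∑ k ∈ S, h k) → g t = 0) ∧
      ∀ z, z ≠ 0 → ∫ t, Real.exp (-z * t) * g t =
        (1 - Real.exp (-z * b)) / z * ∏ k ∈ S, (1 - Real.exp ((lam k - z) * h k)) := by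
  induction S using Finset.induction_on with
  | empty =>
    refine ⟨(Set.Icc 0 b).indicator 1, measurable_one.indicator measurableSet_Icc, ?_, ?_, ?_⟩
    · intro t
      by_cases ht : t ∈ Set.Icc 0 b <;> simp [ht]
    · intro t ht
      rw [Finset.sum_empty, add_zero] at ht
      exact Set.indicator_of_notMem ht _
    · intro z hz
      rw [Finset.prod_empty, mul_one, ← integral_Icc_exp_neg_mul hz hb,
        ← integral_indicator measurableSet_Icc]
      congr 1 with t
      by_cases ht : t ∈ Set.Icc 0 b <;> simp [ht]
  | insert a S ha ih =>
    obtain ⟨g, hgm, hgb, hgs, hgi⟩ := ih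
    refine ⟨fun t => g t - Real.exp (lam a * h a) * g (t - h a), by fun_prop, ?_, ?_, ?_⟩
    · intro t
      rw [Finset.prod_insert ha]
      calc |g t - Real.exp (lam a * h a) * g (t - h a)|
          ≤ |g t| + |Real.exp (lam a * h a) * g (t - h a)| := abs_sub _ _
        _ = |g t| + Real.exp (lam a * h a) * |g (t - h a)| := by rw [abs_mul, Real.abs_exp]
        _ ≤ _ := by
          rw [add_mul, one_mul]
          exact add_le_add (hgb _) (mul_le_mul_of_nonneg_left (hgb _) (Real.exp_pos _).le)
    · intro t ht
      have h0 := hh a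
      have hsum : 0 ≤ ∑ k ∈ S, h k := Finset.sum_nonneg fun k _ => hh k
      rw [Finset.sum_insert ha] at ht
      have h1 : g t = 0 := hgs t fun hc => ht ⟨hc.1, by linarith [hc.2]⟩
      have h2 : g (t - h a) = 0 :=
        hgs _ fun hc => ht ⟨by linarith [hc.1], by linarith [hc.2]⟩
      simp [h1, h2]
    · intro z hz
      have hI := integrable_exp_mul_of_bounded_of_support hgm hgb hgs z
      have hE : ∀ t, Real.exp (-z * t) * (g t - Real.exp (lam a * h a) * g (t - h a)) =
          Real.exp (-z * t) * g t - Real.exp ((lam a - z) * h a) *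
            (Real.exp (-z * (t - h a)) * g (t - h a)) := by
        intro t
        have : Real.exp (-z * t) * Real.exp (lam a * h a) =
            Real.exp ((lam a - z) * h a) * Real.exp (-z * (t - h a)) := by
          rw [← Real.exp_add, ← Real.exp_add]
          ring_nf
        linear_combination (-g (t - h a)) * this
      simp_rw [hE]
      rw [integral_sub hI ((hI.comp_sub_right (h a)).const_mul _), integral_const_mul,
        integral_sub_right_eq_self (fun t => Real.exp (-z * t) * g t), hgi z hz,
        Finset.prod_insert ha]
      ring

/-- In a Hilbert space, a moment problem whose finite sections have uniformly bounded solutions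
is solvable. -/
theorem exists_inner_eq_of_bounded_sections {𝕜 H : Type*} [RCLike 𝕜] [NormedAddCommGroup H]
    [InnerProductSpace 𝕜 H] [CompleteSpace H] (e : ℕ → H) (m : ℕ → 𝕜) (B : ℝ)
    (hx : ∀ N, ∃ x : H, ‖x‖ ≤ B ∧ ∀ k < N, inner 𝕜 x (e k) = m k) :
    ∃ x : H, ∀ k, inner 𝕜 x (e k) = m k := by
  -- Solutions of the first `N` equations in a ball form decreasing nonempty weak-* compact sets, by
  -- Banach–Alaoglu; a common point solves every equation.
  let K : ℕ → Set (WeakDual 𝕜 H) := fun N =>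
    (WeakDual.toStrongDual ⁻¹' Metric.closedBall (0 : StrongDual 𝕜 H) B) ∩
      ⋂ k ∈ Set.Iio N, {φ : WeakDual 𝕜 H | φ (e k) = m k}
  have hcl : ∀ N, IsClosed (⋂ k ∈ Set.Iio N, {φ : WeakDual 𝕜 H | φ (e k) = m k}) := fun N =>
    isClosed_biInter fun k _ => isClosed_eq (WeakDual.eval_continuous (e k)) continuous_const
  have hcp := WeakDual.isCompact_closedBall (𝕜 := 𝕜) (E := H) 0 B
  have hne : (⋂ N, K N).Nonempty := by
    refine IsCompact.nonempty_iInter_of_sequence_nonempty_isCompact_isClosed K ?_ ?_ ?_ ?_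
    · intro N φ hφ
      refine ⟨hφ.1, ?_⟩
      have := hφ.2
      simp only [Set.mem_iInter, Set.mem_Iio] at this ⊢
      exact fun k hk => this k (by omega)
    · intro N
      obtain ⟨x, hxB, hxk⟩ := hx N
      refine ⟨StrongDual.toWeakDual (InnerProductSpace.toDual 𝕜 H x), ?_, ?_⟩
      · simpa using hxB
      · simp only [Set.mem_iInter, Set.mem_Iio]
        intro k hk
        simpa using hxk k hk
    · exact hcp.inter_right (hcl 0)
    · exact fun N => hcp.isClosed.inter (hcl N)
  obtain ⟨φ, hφ⟩ := hne
  refine ⟨(InnerProductSpace.toDual 𝕜 H).symm (WeakDual.toStrongDual φ), fun k => ?_⟩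
  have h1 := (Set.mem_iInter.1 hφ (k + 1)).2
  simp only [Set.mem_iInter, Set.mem_Iio] at h1
  have h2 : φ (e k) = m k := h1 k (by omega)
  rw [InnerProductSpace.toDual_symm_apply]
  exact h2

/-! ### Growth and separation of the exponents -/

theorem HasPowerGrowth.exists_lower_bound {μ : ℕ → ℝ} (hμ : HasPowerGrowth μ)
    (hpos : ∀ n, 0 < μ n) (hmono : StrictMono μ) :
    ∃ a β : ℝ, 0 < a ∧ 1 < β ∧ ∀ n : ℕ, a * ((n : ℝ) + 1) ^ β ≤ μ n := by
  obtain ⟨M, σ, β, hM, hσ, -, hβ, ε, hε, hμε⟩ := hμ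
  have hε0 : Tendsto ε atTop (nhds 0) := by
    refine hε.trans_tendsto ?_
    exact (tendsto_rpow_neg_atTop hσ).comp
      (tendsto_atTop_add_const_right _ 1 tendsto_natCast_atTop_atTop)
  obtain ⟨N, hN⟩ := eventually_atTop.1 (hε0.eventually (lt_mem_nhds (show (-1 / 2 : ℝ) < 0 by norm_num)))
  have hNp : 0 < ((N : ℝ) + 1) ^ β := by positivity
  refine ⟨min (M / 2) (μ 0 / ((N : ℝ) + 1) ^ β), β,
    lt_min (by positivity) (div_pos (hpos 0) hNp), hβ, fun n => ?_⟩
  have hn : 0 < ((n : ℝ) + 1) ^ β := by positivity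
  rcases le_total N n with h | h
  · calc _ ≤ M / 2 * ((n : ℝ) + 1) ^ β := by gcongr; exact min_le_left _ _
      _ = M * ((n : ℝ) + 1) ^ β * (1 / 2) := by ring
      _ ≤ M * ((n : ℝ) + 1) ^ β * (1 + ε n) := by
        gcongr
        linarith [hN n h]
      _ = μ n := (hμε n).symm
  · calc _ ≤ μ 0 / ((N : ℝ) + 1) ^ β * ((n : ℝ) + 1) ^ β := by gcongr; exact min_le_right _ _
      _ ≤ μ 0 / ((N : ℝ) + 1) ^ β * ((N : ℝ) + 1) ^ β := by
        have := (hpos 0).le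
        gcongr
      _ = μ 0 := div_mul_cancel₀ _ hNp.ne'
      _ ≤ μ n := hmono.monotone (Nat.zero_le n)

theorem gap_le_abs_sub {μ : ℕ → ℝ} (hmono : StrictMono μ) {θ s : ℝ} (hθ : 0 < θ) (hs : 0 ≤ s)
    (hgap : ∀ n : ℕ, θ * ((n : ℝ) + 1) ^ (-s) ≤ μ (n + 1) - μ n) {k n : ℕ} (hkn : k ≠ n) {R : ℝ}
    (hk : (k : ℝ) + 1 ≤ R) (hn : (n : ℝ) + 1 ≤ R) : θ * R ^ (-s) ≤ |μ k - μ n| := by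
  have key : ∀ i j : ℕ, i < j → (j : ℝ) + 1 ≤ R → θ * R ^ (-s) ≤ μ j - μ i := by
    intro i j hij hj
    obtain ⟨j, rfl⟩ : ∃ l, j = l + 1 := ⟨j - 1, by omega⟩
    have h1 : μ i ≤ μ j := hmono.monotone (by omega)
    have h2 : R ^ (-s) ≤ ((j : ℝ) + 1) ^ (-s) :=
      Real.rpow_le_rpow_of_nonpos (by positivity) (by push_cast at hj; linarith) (by linarith)
    linarith [hgap j, mul_le_mul_of_nonneg_left h2 hθ.le]
  rcases lt_or_gt_of_ne hkn with h | h
  · rw [abs_sub_comm]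
    exact (key k n h hn).trans (le_abs_self _)
  · exact (key n k h hk).trans (le_abs_self _)

/-! ### Elementary estimates for one factor -/

theorem one_sub_exp_neg_pos {x : ℝ} (hx : 0 < x) : 0 < 1 - Real.exp (-x) := by
  simpa using hx

theorem neg_log_one_sub_exp_neg_le {x : ℝ} (hx : 0 < x) :
    -Real.log (1 - Real.exp (-x)) ≤ Real.log (1 + 1 / x) := by
  rw [← Real.log_inv]
  refine Real.log_le_log (inv_pos.2 (one_sub_exp_neg_pos hx)) ?_
  rw [inv_le_comm₀ (one_sub_exp_neg_pos hx) (by positivity), Real.exp_neg]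
  have h1 : (Real.exp x)⁻¹ ≤ (x + 1)⁻¹ := by
    gcongr
    exact Real.add_one_le_exp x
  have h2 : (1 + 1 / x)⁻¹ = 1 - (x + 1)⁻¹ := by field_simp; ring
  linarith

theorem neg_log_one_sub_exp_neg_anti {x y : ℝ} (hx : 0 < x) (hxy : x ≤ y) :
    -Real.log (1 - Real.exp (-y)) ≤ -Real.log (1 - Real.exp (-x)) := by
  refine neg_le_neg (Real.log_le_log (one_sub_exp_neg_pos hx) ?_)
  gcongr

theorem neg_log_one_sub_exp_neg_le_mul {x y : ℝ} (hx : 0 < x) (hxy : x ≤ y) :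
    -Real.log (1 - Real.exp (-y)) ≤ (1 - Real.exp (-x))⁻¹ * Real.exp (-y) := by
  have hy := one_sub_exp_neg_pos (hx.trans_le hxy)
  rw [← Real.log_inv]
  refine (Real.log_le_sub_one_of_pos (inv_pos.2 hy)).trans ?_
  have h1 : (1 - Real.exp (-y))⁻¹ - 1 = (1 - Real.exp (-y))⁻¹ * Real.exp (-y) := by
    field_simp; ring
  rw [h1]
  have := one_sub_exp_neg_pos hx
  gcongr

/-- When `x > y` the denominator is itself of size `e^{(x-y)h}`, so the quotient grows only like
`e^{min(x,y)h}`. This cancellation keeps the product bounded as factors with large `μ_k` are added.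
-/
theorem one_add_exp_div_abs_le {x y h : ℝ} (hh : 0 < h) (hxy : x ≠ y) :
    (1 + Real.exp (x * h)) / |1 - Real.exp ((x - y) * h)| ≤
      Real.exp (min x y * h + Real.exp (-(x * h)) + -Real.log (1 - Real.exp (-(|x - y| * h)))) := by
  have hd : 0 < |x - y| * h := mul_pos (abs_pos.2 (sub_ne_zero.2 hxy)) hh
  have hp := one_sub_exp_neg_pos hd
  have key : (1 + Real.exp (x * h)) / |1 - Real.exp ((x - y) * h)| =
      Real.exp (min x y * h) * (Real.exp (-(x * h)) + 1) / (1 - Real.exp (-(|x - y| * h))) := by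
    rcases lt_or_gt_of_ne hxy with hlt | hlt
    · have e1 : -(|x - y| * h) = (x - y) * h := by
        rw [abs_of_neg (sub_neg.2 hlt)]; ring
      rw [e1] at hp ⊢
      rw [min_eq_left hlt.le, abs_of_pos hp, mul_add, ← Real.exp_add]
      simp
    · have e1 : |x - y| * h = (x - y) * h := by rw [abs_of_pos (sub_pos.2 hlt)]
      rw [e1] at hp hd ⊢
      have h2 : 1 - Real.exp ((x - y) * h) < 0 := by
        rw [sub_neg]; exact Real.one_lt_exp_iff.2 hd
      rw [min_eq_right hlt.le, abs_of_neg h2, div_eq_div_iff (by linarith) hp.ne']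
      have e3 : Real.exp (x * h) = Real.exp (y * h) * Real.exp ((x - y) * h) := by
        rw [← Real.exp_add]; ring_nf
      rw [Real.exp_neg, Real.exp_neg, e3]
      field_simp
      ring
  rw [key, Real.exp_add, Real.exp_add, Real.exp_neg (Real.log _), Real.exp_log hp, div_eq_mul_inv]
  gcongr
  exact Real.add_one_le_exp _

theorem summable_exp_neg_mul_rpow {A γ : ℝ} (hA : 0 < A) (hγ : 0 < γ) :
    Summable fun k : ℕ => Real.exp (-(A * ((k : ℝ) + 1) ^ γ)) := by
  have h1 : Tendsto (fun k : ℕ => (k : ℝ) + 1) atTop atTop :=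
    tendsto_atTop_add_const_right _ 1 tendsto_natCast_atTop_atTop
  have h2 := ((isLittleO_exp_neg_mul_rpow_atTop hA (-2 / γ)).comp_tendsto
    ((tendsto_rpow_atTop hγ).comp h1)).isBigO
  have h3 : Summable fun k : ℕ => ((k : ℝ) + 1) ^ (-2 : ℝ) := by
    have := (summable_nat_add_iff 1).2 (Real.summable_nat_rpow.2 (show (-2 : ℝ) < -1 by norm_num))
    simpa using this
  refine summable_of_isBigO_nat h3 (h2.congr (fun k => ?_) fun k => ?_)
  · simp only [Function.comp, neg_mul]
  · simp only [Function.comp]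
    rw [← Real.rpow_mul (by positivity), mul_div_cancel₀ _ hγ.ne']

theorem exists_mul_rpow_le {D α β δ : ℝ} (hD : 0 ≤ D) (hα : 0 ≤ α) (hαβ : α < β) (hδ : 0 < δ) :
    ∃ C, 0 ≤ C ∧ ∀ R, 0 < R → D * R ^ α ≤ C + δ * R ^ β := by
  obtain ⟨R₀, hR₀⟩ := eventually_atTop.1
    ((tendsto_rpow_atTop (sub_pos.2 hαβ)).eventually_ge_atTop (D / δ))
  refine ⟨D * |R₀| ^ α, by positivity, fun R hR => ?_⟩
  rcases le_total R₀ R with h | h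
  · have h1 : D ≤ δ * R ^ (β - α) := by
      have := hR₀ R h
      rwa [div_le_iff₀' hδ] at this
    calc D * R ^ α ≤ δ * R ^ (β - α) * R ^ α := by gcongr
      _ = δ * R ^ β := by rw [mul_assoc, ← Real.rpow_add hR]; simp
      _ ≤ _ := le_add_of_nonneg_left (by positivity)
  · calc D * R ^ α ≤ D * |R₀| ^ α := by gcongr; exact h.trans (le_abs_self _)
      _ ≤ _ := le_add_of_nonneg_right (by positivity)

theorem exists_mul_log_le {Q q β δ : ℝ} (hQ : 0 < Q) (hq : 0 < q) (hβ : 1 < β) (hδ : 0 < δ) :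
    ∃ C, 0 ≤ C ∧ ∀ R, 1 ≤ R → R * Real.log (1 + Q * R ^ q) ≤ C + δ * R ^ β := by
  -- Bounding the logarithm by an `ε`-th power gives the exponent `1 + qε = (1 + β)/2 < β`.
  set ε := (β - 1) / (2 * q) with hε
  have hε0 : 0 < ε := div_pos (by linarith) (by positivity)
  obtain ⟨C, hC0, hC⟩ := exists_mul_rpow_le (D := (1 + Q) ^ ε / ε) (α := 1 + q * ε) (β := β)
    (by positivity) (by positivity) (by rw [hε]; field_simp; linarith) hδ
  refine ⟨C, hC0, fun R hR => le_trans ?_ (hC R (by linarith))⟩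
  have hR0 : 0 < R := by linarith
  have h1 : 1 + Q * R ^ q ≤ (1 + Q) * R ^ q := by
    have := Real.one_le_rpow hR hq.le
    linarith
  calc R * Real.log (1 + Q * R ^ q) ≤ R * (((1 + Q) * R ^ q) ^ ε / ε) := by
        gcongr
        exact (Real.log_le_log (by positivity) h1).trans (Real.log_le_rpow_div (by positivity) hε0)
    _ = (1 + Q) ^ ε / ε * R ^ (1 + q * ε) := by
        rw [Real.mul_rpow (by positivity) (by positivity), ← Real.rpow_mul hR0.le,
          Real.rpow_add hR0, Real.rpow_one]
        ring

/-! ### Bounds for the logarithm of the product -/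

/-- Outside a finite set the `h k` sum to less than `δ`, and the minimum is at most `μ n`; on that
set it is at most `μ k`, giving a constant. -/
theorem exists_sum_min_mul_le {μ h : ℕ → ℝ} (hpos : ∀ n, 0 < μ n) (hh : ∀ k, 0 ≤ h k)
    (hsum : Summable h) {δ : ℝ} (hδ : 0 < δ) :
    ∃ C, ∀ n, ∀ S : Finset ℕ, ∑ k ∈ S, min (μ k) (μ n) * h k ≤ C + δ * μ n := by
  obtain ⟨s, hs⟩ := summable_iff_vanishing_norm.1 hsum δ hδ
  refine ⟨∑ k ∈ s, μ k * h k, fun n S => ?_⟩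
  rw [← Finset.sum_inter_add_sum_sdiff S s]
  have hn := hpos n
  refine add_le_add ?_ ?_
  · calc ∑ k ∈ S ∩ s, min (μ k) (μ n) * h k ≤ ∑ k ∈ S ∩ s, μ k * h k :=
          Finset.sum_le_sum fun k _ => mul_le_mul_of_nonneg_right (min_le_left _ _) (hh k)
      _ ≤ _ := Finset.sum_le_sum_of_subset_of_nonneg Finset.inter_subset_right
          fun k _ _ => mul_nonneg (hpos k).le (hh k)
  · calc ∑ k ∈ S \ s, min (μ k) (μ n) * h k ≤ ∑ k ∈ S \ s, μ n * h k :=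
          Finset.sum_le_sum fun k _ => mul_le_mul_of_nonneg_right (min_le_right _ _) (hh k)
      _ = (∑ k ∈ S \ s, h k) * μ n := by rw [← Finset.mul_sum, mul_comm]
      _ ≤ δ * μ n := by
        gcongr
        exact (le_abs_self _).trans (hs _ Finset.sdiff_disjoint).le

/-- Terms with `μ k ≥ 2 μ n` are dominated by a convergent series independent of `n`. The others
number at most `R`, of order `μ_n^{1/β}`, and the gap condition makes each `O(log R)`; since `β >
1`, `R log R` is negligible against `μ n`. -/
theorem exists_sum_neg_log_le {μ : ℕ → ℝ} (hmono : StrictMono μ)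
    {a β θ s c p δ : ℝ} (ha : 0 < a) (hβ : 1 < β) (hlow : ∀ n : ℕ, a * ((n : ℝ) + 1) ^ β ≤ μ n)
    (hθ : 0 < θ) (hs : 0 ≤ s) (hgap : ∀ n : ℕ, θ * ((n : ℝ) + 1) ^ (-s) ≤ μ (n + 1) - μ n)
    (hc : 0 < c) (hp : 0 < p) (hpβ : p < β) (hδ : 0 < δ) :
    ∃ C, ∀ n, ∀ S : Finset ℕ, n ∉ S →
      ∑ k ∈ S, -Real.log (1 - Real.exp (-(|μ k - μ n| * (c * ((k : ℝ) + 1) ^ (-p))))) ≤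
        C + δ * μ n := by
  -- The half comes from `μ k - μ n ≥ μ k / 2` for the far terms.
  set A := a * c / 2 with hA
  have hA0 : 0 < A := by positivity
  have hμpos : ∀ n, 0 < μ n := fun n => lt_of_lt_of_le (by positivity) (hlow n)
  have hsum := (summable_exp_neg_mul_rpow hA0 (sub_pos.2 hpβ)).mul_left (1 - Real.exp (-A))⁻¹
  have hA1 := one_sub_exp_neg_pos hA0
  obtain ⟨C, hC0, hC⟩ := exists_mul_log_le (Q := (θ * c)⁻¹) (q := s + p) (β := β) (δ := δ * (a / 2))
    (by positivity) (by positivity) hβ (by positivity)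
  refine ⟨(∑' k : ℕ, (1 - Real.exp (-A))⁻¹ * Real.exp (-(A * ((k : ℝ) + 1) ^ (β - p)))) + C,
    fun n S hnS => ?_⟩
  rw [← Finset.sum_filter_add_sum_filter_not S (fun k => 2 * μ n ≤ μ k), add_assoc]
  refine add_le_add ?_ ?_
  · refine le_trans (Finset.sum_le_sum fun k hk => ?_)
      (hsum.sum_le_tsum (S.filter fun k => 2 * μ n ≤ μ k) fun k _ => by positivity)
    have hk2 := (Finset.mem_filter.1 hk).2
    have h1 : A ≤ A * ((k : ℝ) + 1) ^ (β - p) :=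
      le_mul_of_one_le_right hA0.le (Real.one_le_rpow (by linarith [Nat.cast_nonneg (α := ℝ) k])
        (by linarith))
    refine le_trans (neg_log_one_sub_exp_neg_anti (x := A * ((k : ℝ) + 1) ^ (β - p))
      (by positivity) ?_) (neg_log_one_sub_exp_neg_le_mul hA0 h1)
    calc A * ((k : ℝ) + 1) ^ (β - p)
        = a * ((k : ℝ) + 1) ^ β / 2 * (c * ((k : ℝ) + 1) ^ (-p)) := by
          rw [sub_eq_add_neg, Real.rpow_add (by positivity)]; ring
      _ ≤ |μ k - μ n| * (c * ((k : ℝ) + 1) ^ (-p)) := by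
          gcongr
          refine le_trans ?_ (le_abs_self _)
          linarith [hlow k]
  · set R := (2 * μ n / a) ^ (1 / β) with hR
    have hRβ : R ^ β = 2 * μ n / a := by
      rw [hR, ← Real.rpow_mul (by have := hμpos n; positivity), one_div_mul_cancel (by linarith),
        Real.rpow_one]
    have hkR : ∀ k, μ k ≤ 2 * μ n → (k : ℝ) + 1 ≤ R := by
      intro k hk
      have hRn : 0 ≤ R := Real.rpow_nonneg (by have := hμpos n; positivity) _
      rw [← Real.rpow_le_rpow_iff (by positivity) hRn (show 0 < β by linarith), hRβ,
        le_div_iff₀' ha]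
      exact (hlow k).trans hk
    have hnR : (n : ℝ) + 1 ≤ R := hkR n (by linarith [hμpos n])
    have hR1 : 1 ≤ R := le_trans (by linarith [Nat.cast_nonneg (α := ℝ) n]) hnR
    have hR0 : 0 < R := by linarith
    have hlog0 : 0 ≤ Real.log (1 + (θ * c)⁻¹ * R ^ (s + p)) :=
      Real.log_nonneg (le_add_of_nonneg_right (by positivity))
    have hterm : ∀ k ∈ S.filter (fun k => ¬ 2 * μ n ≤ μ k),
        -Real.log (1 - Real.exp (-(|μ k - μ n| * (c * ((k : ℝ) + 1) ^ (-p))))) ≤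
          Real.log (1 + (θ * c)⁻¹ * R ^ (s + p)) := by
      intro k hk
      obtain ⟨hkS, hk2⟩ := Finset.mem_filter.1 hk
      have hk1 := hkR k (not_le.1 hk2).le
      have hle : θ * R ^ (-s) * (c * R ^ (-p)) ≤ |μ k - μ n| * (c * ((k : ℝ) + 1) ^ (-p)) := by
        refine mul_le_mul (gap_le_abs_sub hmono hθ hs hgap (by rintro rfl; exact hnS hkS) hk1 hnR)
          ?_ (by positivity) (abs_nonneg _)
        exact mul_le_mul_of_nonneg_left
          (Real.rpow_le_rpow_of_nonpos (by positivity) hk1 (by linarith)) hc.le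
      refine (neg_log_one_sub_exp_neg_anti (by positivity) hle).trans
        ((neg_log_one_sub_exp_neg_le (by positivity)).trans (le_of_eq ?_))
      rw [Real.rpow_add hR0, Real.rpow_neg hR0.le, Real.rpow_neg hR0.le]
      congr 2
      field_simp
    refine (Finset.sum_le_card_nsmul _ _ _ hterm).trans ?_
    rw [nsmul_eq_mul]
    have hcard : (((S.filter (fun k => ¬ 2 * μ n ≤ μ k)).card : ℕ) : ℝ) ≤ R := by
      have hsub : S.filter (fun k => ¬ 2 * μ n ≤ μ k) ⊆ Finset.range ⌊R⌋₊ := by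
        intro k hk
        have := hkR k (not_le.1 (Finset.mem_filter.1 hk).2).le
        rw [Finset.mem_range, ← Nat.succ_le_iff]
        exact Nat.le_floor (by push_cast; exact this)
      have := Finset.card_le_card hsub
      rw [Finset.card_range] at this
      exact (Nat.cast_le.2 this).trans (Nat.floor_le hR0.le)
    calc _ ≤ R * Real.log (1 + (θ * c)⁻¹ * R ^ (s + p)) := by gcongr
      _ ≤ C + δ * (a / 2) * R ^ β := hC R hR1
      _ = C + δ * μ n := by rw [hRβ]; field_simp

theorem mul_inv_one_sub_exp_neg_le {x₀ x b δ : ℝ} (hx₀ : 0 < x₀) (hx : x₀ ≤ x) (hb : 0 < b)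
    (hδ : 0 < δ) :
    x / (1 - Real.exp (-x * b)) ≤ Real.exp (δ * x) / (δ * (1 - Real.exp (-(x₀ * b)))) := by
  have h1 : x ≤ Real.exp (δ * x) / δ := by
    rw [le_div_iff₀' hδ]
    linarith [Real.add_one_le_exp (δ * x)]
  have h0 := one_sub_exp_neg_pos (mul_pos hx₀ hb)
  have h2 : 1 - Real.exp (-(x₀ * b)) ≤ 1 - Real.exp (-x * b) := by
    rw [neg_mul]
    gcongr
  rw [← div_div]
  gcongr

/-- Finite biorthogonal systems to `e^{-μ_k t}` on `[0, T]`, with bounds uniform in their size. -/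
theorem exists_biorthogonal_section {μ : ℕ → ℝ} (hpos : ∀ n, 0 < μ n) (hmono : StrictMono μ)
    (hgrowth : HasPowerGrowth μ) (hgap : HasPowerGap μ) {T δ : ℝ} (hT : 0 < T) (hδ : 0 < δ) :
    ∃ C : ℝ, ∀ N n : ℕ, ∃ g : ℝ → ℝ, Measurable g ∧
      (∀ t, |g t| ≤ C * Real.exp (δ * μ n)) ∧ (∀ t, t ∉ Set.Icc 0 T → g t = 0) ∧
      ∀ k < N, ∫ t, Real.exp (-(μ k) * t) * g t = if k = n then 1 else 0 := by
  obtain ⟨a, β, ha, hβ, hlow⟩ := hgrowth.exists_lower_bound hpos hmono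
  obtain ⟨θ, s, hθ, hs, hgap⟩ := hgap
  -- `p > 1` makes the shifts summable; `p < β` makes `μ k * h k` grow like a positive power of `k`,
  -- at least.
  set p := (1 + β) / 2 with hp
  have hp1 : 1 < p := by rw [hp]; linarith
  have hpβ : p < β := by rw [hp]; linarith
  have hsum0 : Summable fun k : ℕ => ((k : ℝ) + 1) ^ (-p) := by
    have := (summable_nat_add_iff 1).2 (Real.summable_nat_rpow.2 (show -p < -1 by linarith))
    simpa using this
  have hts : 0 < ∑' k : ℕ, ((k : ℝ) + 1) ^ (-p) :=
    hsum0.tsum_pos (fun k => by positivity) 0 (by positivity)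
  set c := T / 2 / ∑' k : ℕ, ((k : ℝ) + 1) ^ (-p) with hc
  have hc0 : 0 < c := by positivity
  -- The shifts use up half of `T`; the indicator uses the other half.
  set h : ℕ → ℝ := fun k => c * ((k : ℝ) + 1) ^ (-p) with hh
  have hhpos : ∀ k, 0 < h k := fun k => by positivity
  have hsumh : Summable h := hsum0.mul_left c
  have hhT : ∑' k, h k = T / 2 := by
    rw [hh, tsum_mul_left, hc, div_mul_cancel₀ _ hts.ne']
  have hsume : Summable fun k => Real.exp (-(μ k * h k)) := by
    refine Summable.of_nonneg_of_le (fun k => (Real.exp_pos _).le) (fun k => ?_)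
      (summable_exp_neg_mul_rpow (mul_pos ha hc0) (sub_pos.2 hpβ))
    refine Real.exp_le_exp.2 (neg_le_neg ?_)
    calc a * c * ((k : ℝ) + 1) ^ (β - p)
        = a * ((k : ℝ) + 1) ^ β * (c * ((k : ℝ) + 1) ^ (-p)) := by
          rw [sub_eq_add_neg, Real.rpow_add (by positivity)]; ring
      _ ≤ μ k * h k := mul_le_mul_of_nonneg_right (hlow k) (hhpos k).le
  -- One third each for the sum of minima, the sum of logarithms, and the factor `μ n / (1 - e^{-μ n
  -- T/2})`.
  have hδ3 : 0 < δ / 3 := by positivity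
  obtain ⟨C₁, hC₁⟩ := exists_sum_min_mul_le hpos (fun k => (hhpos k).le) hsumh hδ3
  obtain ⟨C₂, hC₂⟩ := exists_sum_neg_log_le hmono ha hβ hlow hθ hs hgap hc0
    (zero_lt_one.trans hp1) hpβ hδ3
  set E := ∑' k, Real.exp (-(μ k * h k)) with hE
  have hT2 : 0 < T / 2 := by positivity
  refine ⟨(δ / 3 * (1 - Real.exp (-(μ 0 * (T / 2)))))⁻¹ * Real.exp (C₁ + E + C₂), fun N n => ?_⟩
  set S := (Finset.range N).erase n with hS
  have hnS : n ∉ S := Finset.notMem_erase n _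
  obtain ⟨g, hgm, hgb, hgs, hgi⟩ :=
    exists_bounded_laplace_eq_prod μ h (fun k => (hhpos k).le) hT2.le S
  set D := (1 - Real.exp (-(μ n) * (T / 2))) / μ n *
    ∏ k ∈ S, (1 - Real.exp ((μ k - μ n) * h k)) with hD
  have hne : ∀ k ∈ S, μ k ≠ μ n := fun k hk => hmono.injective.ne (Finset.ne_of_mem_erase hk)
  have hfac : 0 < (1 - Real.exp (-(μ n) * (T / 2))) / μ n := by
    rw [neg_mul]
    exact div_pos (one_sub_exp_neg_pos (mul_pos (hpos n) hT2)) (hpos n)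
  have hD0 : D ≠ 0 := by
    refine mul_ne_zero hfac.ne' (Finset.prod_ne_zero_iff.2 fun k hk => ?_)
    rw [sub_ne_zero]
    exact fun hc => mul_ne_zero (sub_ne_zero.2 (hne k hk)) (hhpos k).ne'
      (Real.exp_eq_one_iff _ |>.1 hc.symm)
  refine ⟨fun t => D⁻¹ * g t, by fun_prop, fun t => ?_, fun t ht => ?_, fun k hk => ?_⟩
  · have hprod : (∏ k ∈ S, (1 + Real.exp (μ k * h k))) /
        |∏ k ∈ S, (1 - Real.exp ((μ k - μ n) * h k))| ≤
          Real.exp (C₁ + E + C₂ + 2 * (δ / 3) * μ n) := by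
      rw [Finset.abs_prod, ← Finset.prod_div_distrib]
      refine (Finset.prod_le_prod (fun k _ => by positivity)
        (fun k hk => one_add_exp_div_abs_le (hhpos k) (hne k hk))).trans ?_
      rw [← Real.exp_sum, Finset.sum_add_distrib, Finset.sum_add_distrib]
      refine Real.exp_le_exp.2 ?_
      have h1 := hC₁ n S
      have h2 := hC₂ n S hnS
      have h3 : ∑ k ∈ S, Real.exp (-(μ k * h k)) ≤ E :=
        hsume.sum_le_tsum S fun k _ => (Real.exp_pos _).le
      linarith
    have hfirst := mul_inv_one_sub_exp_neg_le (hpos 0) (hmono.monotone (Nat.zero_le n)) hT2 hδ3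
    calc |D⁻¹ * g t| ≤ |D|⁻¹ * ∏ k ∈ S, (1 + Real.exp (μ k * h k)) := by
          rw [abs_mul, abs_inv]
          gcongr
          exact hgb t
      _ = μ n / (1 - Real.exp (-(μ n) * (T / 2))) * ((∏ k ∈ S, (1 + Real.exp (μ k * h k))) /
            |∏ k ∈ S, (1 - Real.exp ((μ k - μ n) * h k))|) := by
          rw [hD, abs_mul, abs_of_pos hfac, mul_inv, inv_div]
          ring
      _ ≤ Real.exp (δ / 3 * μ n) / (δ / 3 * (1 - Real.exp (-(μ 0 * (T / 2))))) *
            Real.exp (C₁ + E + C₂ + 2 * (δ / 3) * μ n) := by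
          have := one_sub_exp_neg_pos (mul_pos (hpos 0) hT2)
          refine mul_le_mul hfirst hprod (by positivity) (by positivity)
      _ = _ := by
          rw [div_eq_inv_mul, mul_assoc, ← Real.exp_add, mul_assoc _⁻¹, ← Real.exp_add]
          congr 2
          ring
  · have : g t = 0 := hgs t fun hc => ht ⟨hc.1, hc.2.trans ?_⟩
    · simp [this]
    · have := hsumh.sum_le_tsum S fun k _ => (hhpos k).le
      linarith
  · have : ∀ t, Real.exp (-(μ k) * t) * (D⁻¹ * g t) = D⁻¹ * (Real.exp (-(μ k) * t) * g t) :=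
      fun t => by ring
    simp_rw [this]
    rw [integral_const_mul, hgi _ (hpos k).ne']
    split_ifs with hkn
    · subst hkn
      exact inv_mul_cancel₀ hD0
    · rw [Finset.prod_eq_zero (Finset.mem_erase.2 ⟨hkn, Finset.mem_range.2 hk⟩ : k ∈ S) (by simp)]
      simp

/-! ### From finite sections to the moment problem -/

theorem exists_moment_solution_of_summable {𝕜 : Type*} [RCLike 𝕜] {μ : ℕ → ℝ} {m : ℕ → 𝕜}
    {T : ℝ} {C : ℕ → ℝ}
    (hg : ∀ N n : ℕ, ∃ g : ℝ → ℝ, Measurable g ∧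
      (∀ t, |g t| ≤ C n) ∧ (∀ t, t ∉ Set.Icc 0 T → g t = 0) ∧
      ∀ k < N, ∫ t, Real.exp (-(μ k) * t) * g t = if k = n then 1 else 0)
    (hm : Summable fun n => ‖m n‖ * C n) :
    ∃ ν : ℝ → 𝕜, MemLp ν 2 (volume.restrict (Set.Icc 0 T)) ∧
      ∀ n, ∫ t in Set.Icc 0 T, ((Real.exp (-(μ n) * t) : ℝ) : 𝕜) * ν t = m n := by
  set ρ : Measure ℝ := volume.restrict (Set.Icc 0 T) with hρ
  have : IsFiniteMeasure ρ := ⟨by simp [hρ]⟩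
  have hC : ∀ n, 0 ≤ C n := fun n => by
    obtain ⟨g, -, hb, -⟩ := hg 0 n
    exact (abs_nonneg _).trans (hb 0)
  have he : ∀ k, MemLp (fun t => ((Real.exp (-(μ k) * t) : ℝ) : 𝕜)) 2 ρ := by
    intro k
    refine MemLp.of_bound (by fun_prop) (Real.exp (|μ k| * |T|)) ?_
    rw [hρ, ae_restrict_iff' measurableSet_Icc]
    refine Eventually.of_forall fun t ht => ?_
    rw [RCLike.norm_ofReal, Real.abs_exp, Real.exp_le_exp]
    calc -(μ k) * t ≤ |μ k| * t := mul_le_mul_of_nonneg_right (neg_le_abs _) ht.1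
      _ ≤ |μ k| * |T| := mul_le_mul_of_nonneg_left (ht.2.trans (le_abs_self T)) (abs_nonneg _)
  have hinner : ∀ k (x : Lp 𝕜 2 ρ), inner 𝕜 ((he k).toLp _) x =
      ∫ t, ((Real.exp (-(μ k) * t) : ℝ) : 𝕜) * x t ∂ρ := by
    intro k x
    rw [L2.inner_def]
    refine integral_congr_ae ?_
    filter_upwards [(he k).coeFn_toLp] with t ht
    rw [ht, RCLike.inner_apply, RCLike.conj_ofReal, mul_comm]
  set B := ∑' n, ‖m n‖ * C n with hB
  have hB0 : 0 ≤ B := tsum_nonneg fun n => mul_nonneg (norm_nonneg _) (hC n)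
  -- The unknown sits in the conjugate-linear slot, so the targets are conjugated. The norm bound is
  -- the sup bound `B` times the `L²` norm of `1`.
  obtain ⟨x, hx⟩ := exists_inner_eq_of_bounded_sections (𝕜 := 𝕜) (fun k => (he k).toLp _)
    (fun k => starRingEnd 𝕜 (m k)) (measureUnivNNReal ρ ^ (2 : ENNReal).toReal⁻¹ * B) (by
      intro N
      choose g hgm hgb hgs hgi using hg N
      have hνb : ∀ t, ‖∑ n ∈ Finset.range N, m n * ((g n t : ℝ) : 𝕜)‖ ≤ B := by
        intro t
        refine (norm_sum_le _ _).trans (le_trans (Finset.sum_le_sum fun n _ => ?_)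
          (hm.sum_le_tsum (Finset.range N) fun n _ => mul_nonneg (norm_nonneg _) (hC n)))
        rw [norm_mul, RCLike.norm_ofReal]
        exact mul_le_mul_of_nonneg_left (hgb n t) (norm_nonneg _)
      have hνL : MemLp (fun t => ∑ n ∈ Finset.range N, m n * ((g n t : ℝ) : 𝕜)) 2 ρ :=
        MemLp.of_bound (by fun_prop) B (Eventually.of_forall hνb)
      refine ⟨hνL.toLp _, ?_, fun k hk => ?_⟩
      · refine Lp.norm_le_of_ae_bound hB0 ?_
        filter_upwards [hνL.coeFn_toLp] with t ht
        rw [ht]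
        exact hνb t
      · rw [← inner_conj_symm, hinner]
        congr 1
        have h1 : ∫ t, ((Real.exp (-(μ k) * t) : ℝ) : 𝕜) * (hνL.toLp _ : Lp 𝕜 2 ρ) t ∂ρ =
            ∫ t, ∑ n ∈ Finset.range N,
              m n * ((Real.exp (-(μ k) * t) * g n t : ℝ) : 𝕜) ∂ρ := by
          refine integral_congr_ae ?_
          filter_upwards [hνL.coeFn_toLp] with t ht
          rw [ht, Finset.mul_sum]
          refine Finset.sum_congr rfl fun n _ => ?_
          push_cast
          ring
        have hint := fun n =>
          integrable_exp_mul_of_bounded_of_support (hgm n) (hgb n) (hgs n) (μ k)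
        rw [h1, integral_finsetSum _ fun n _ => ((hint n).ofReal.mono_measure
          Measure.restrict_le_self).const_mul _]
        have h2 : ∀ n, ∫ t, m n * ((Real.exp (-(μ k) * t) * g n t : ℝ) : 𝕜) ∂ρ =
            if k = n then m n else 0 := by
          intro n
          rw [integral_const_mul, integral_ofReal, hρ, setIntegral_eq_integral_of_forall_compl_eq_zero
            (fun t ht => by rw [hgs n t ht, mul_zero]), hgi n k hk]
          split_ifs <;> simp
        simp_rw [h2]
        simp [hk])
  refine ⟨x, Lp.memLp x, fun n => ?_⟩
  rw [← hinner, ← inner_conj_symm, hx, RCLike.conj_conj]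

theorem exists_isMomentSolution_of_le {𝕜 : Type*} [RCLike 𝕜] {μ : ℕ → ℝ} {m : ℕ → 𝕜} {T : ℝ}
    {T' : EReal} (hT : (T : EReal) ≤ T') {ν : ℝ → 𝕜}
    (hν : MemLp ν 2 (volume.restrict (Set.Icc 0 T)))
    (hm : ∀ n, ∫ t in Set.Icc 0 T, ((Real.exp (-(μ n) * t) : ℝ) : 𝕜) * ν t = m n) :
    IsMomentSolution μ m T' ((Set.Icc 0 T).indicator ν) := by
  have hsub : Set.Icc 0 T ⊆ timeInterval T' :=
    fun t ht => ⟨ht.1, (EReal.coe_le_coe_iff.2 ht.2).trans hT⟩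
  refine ⟨?_, fun n => ?_⟩
  · rw [memLp_indicator_iff_restrict measurableSet_Icc, Measure.restrict_restrict measurableSet_Icc,
      Set.inter_eq_left.2 hsub]
    exact hν
  · have : ∀ t, ((Real.exp (-(μ n) * t) : ℝ) : 𝕜) * (Set.Icc 0 T).indicator ν t =
        (Set.Icc 0 T).indicator (fun t => ((Real.exp (-(μ n) * t) : ℝ) : 𝕜) * ν t) t :=
      fun t => by by_cases ht : t ∈ Set.Icc 0 T <;> simp [ht]
    simp_rw [this]
    rw [setIntegral_indicator measurableSet_Icc, Set.inter_eq_right.2 hsub, hm]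

theorem mainTheorem5 {𝕜 : Type*} [RCLike 𝕜]
    (μ : ℕ → ℝ) (hpos : ∀ n, 0 < μ n) (hmono : StrictMono μ)
    (hgrowth : HasPowerGrowth μ) (hgap : HasPowerGap μ)
    (c f : ℕ → 𝕜) (hc : ∀ n, c n ≠ 0)
    (T : EReal) (hT : 0 < T) (τ : ℝ) (hτ : 0 < τ)
    (hsum : ∃ τ₀ : ℝ, 0 ≤ τ₀ ∧ τ₀ < τ ∧
      Summable (fun n : ℕ => ‖f n / c n‖ ^ 2 * Real.exp (-2 * μ n * τ₀))) :
    ∃ ν : ℝ → 𝕜,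
      IsMomentSolution μ
        (fun n : ℕ => ((Real.exp (-(μ n) * τ) : ℝ) : 𝕜) * (f n / c n)) T ν := by
  obtain ⟨τ₀, -, hττ, hsum⟩ := hsum
  obtain ⟨T₁, hT₁, hT₁T⟩ := EReal.lt_iff_exists_real_btwn.1 hT
  have hT₁0 : 0 < T₁ := by exact_mod_cast hT₁
  -- Half of the surplus decay pays for the growth of the biorthogonal functions; the other half
  -- leaves a square-summable factor `e^{-δ μ n}`.
  set δ := (τ - τ₀) / 2 with hδ
  have hδ0 : 0 < δ := by rw [hδ]; linarith
  obtain ⟨C, hC⟩ := exists_biorthogonal_section hpos hmono hgrowth hgap hT₁0 hδ0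
  obtain ⟨a, β, ha, hβ, hlow⟩ := hgrowth.exists_lower_bound hpos hmono
  have hexp : Summable fun n => Real.exp (-δ * μ n) ^ 2 := by
    refine Summable.of_nonneg_of_le (fun n => by positivity) (fun n => ?_)
      (summable_exp_neg_mul_rpow (A := 2 * δ * a) (by positivity) (zero_lt_one.trans hβ))
    rw [← Real.exp_nat_mul, Real.exp_le_exp]
    have := mul_le_mul_of_nonneg_left (hlow n) hδ0.le
    push_cast
    linarith
  have hm : Summable fun n => ‖((Real.exp (-(μ n) * τ) : ℝ) : 𝕜) * (f n / c n)‖ *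
      Real.exp (δ * μ n) := by
    refine Summable.of_nonneg_of_le (fun n => by positivity) (fun n => ?_) (hsum.add hexp)
    set r := ‖f n / c n‖ with hr
    have h1 : ‖((Real.exp (-(μ n) * τ) : ℝ) : 𝕜) * (f n / c n)‖ * Real.exp (δ * μ n) =
        (r * Real.exp (-(μ n) * τ₀)) * Real.exp (-δ * μ n) := by
      rw [norm_mul, RCLike.norm_ofReal, Real.abs_exp, ← hr, mul_assoc r, ← Real.exp_add,
        mul_comm _ r, mul_assoc r, ← Real.exp_add]
      congr 2
      rw [hδ]
      ring
    have h2 : r ^ 2 * Real.exp (-2 * μ n * τ₀) = (r * Real.exp (-(μ n) * τ₀)) ^ 2 := by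
      rw [mul_pow, ← Real.exp_nat_mul]
      push_cast
      ring_nf
    rw [h1, h2]
    nlinarith [sq_nonneg (r * Real.exp (-(μ n) * τ₀) - Real.exp (-δ * μ n)),
      sq_nonneg (r * Real.exp (-(μ n) * τ₀)), sq_nonneg (Real.exp (-δ * μ n))]
  obtain ⟨ν, hν, hνm⟩ := exists_moment_solution_of_summable (μ := μ)
    (m := fun n => ((Real.exp (-(μ n) * τ) : ℝ) : 𝕜) * (f n / c n)) hC
    ((hm.mul_left C).congr fun n => by ring)
  exact ⟨_, exists_isMomentSolution_of_le hT₁T.le hν hνm⟩
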